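/- Let $n\ge 1$ and $m\ge 0$ be integers, and let $\mathbb{T}\subseteq\mathbb{R}$ be a time scale, that is, a nonempty closed subset of $\mathbb{R}$, with at least $n+1$ elements. For $t\in\mathbb{T}$ let $\sigma(t)=\inf\{s\in\mathbb{T}: s>t\}$ (and $\sigma(t)=t$ if $t=\max\mathbb{T}$), let $\mu(t)=\sigma(t)-t$, and let $\bar\mu=\sup_{t\in\mathbb{T}}\mu(t)\in[0,\infty]$. Intervals with subscript $\mathbb{T}$ are intersected with $\mathbb{T}$. The delta derivative at $t$ of a function $f$ on a time scale with forward jump operator $\sigma$ is the vector $f^\Delta(t)$ such that for every $\varepsilon>0$ there is a neighbourhood $U$ of $t$ in the time scale with $\|f(\sigma(t))-f(s)-(\sigma(t)-s)f^\Delta(t)\|\le\varepsilon|\sigma(t)-s|$ for all $s\in U$. Let $A\in\mathbb{R}^{n\times n}$, $B\in\mathbb{R}^{n\times m}$, and let $\Sigma$ be the control system $x^\Delta(t)=Ax(t)+Bu(t)$ on $\mathbb{T}$. A control is a function $u:[t_0,t_1)_{\mathbb{T}}\to\mathbb{R}^m$, where $t_0\in\mathbb{T}$ and $t_1>t_0$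 is an element of $\mathbb{T}$ or $\infty$, that has finitely many points of discontinuity in each bounded part of its domain and that at each of them is right-continuous and, if the point is left-dense, has a finite left-sided limit. For $t\in[t_0,t_1]_{\mathbb{T}}$, a solution on $[t_0,t]_{\mathbb{T}}$ with initial condition $x(t_0)=x_0$ is a continuous function on $[t_0,t]_{\mathbb{T}}$ with $x(t_0)=x_0$ that satisfies the equation, with the delta derivative taken on $[t_0,t]_{\mathbb{T}}$, at every $\tau\in[t_0,t)_{\mathbb{T}}$ at which $u$ is continuous, and that at every discontinuity $\tau\in[t_0,t)_{\mathbb{T}}$ of $u$ satisfies the equation with the delta derivative taken on $[\tau,t]_{\mathbb{T}}$. The system $\Sigma$ is called positive if for every $t_0\in\mathbb{T}$, every $x_0\in\mathbb{R}^n$ with nonnegative components, every control $u:[t_0,t_1)_{\mathbb{T}}\to\mathbb{R}^m$ with nonnegative components, and every $t\in[t_0,t_1]_{\mathbb{T}}$, every solution $x$ on $[t_0,t]_{\mathbb{T}}$ with $x(t_0)=x_0$ has $x(t)$ with nonnegative components. Put $A_{\mathbb{T}}=A+I/\bar\mu$, a matrix with entries in $\mathbb{R}\cup\{\infty\}$,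 where $I/\infty$ is the zero matrix and $I/0$ is the diagonal matrix with $\infty$ on the diagonal, and $a+\infty=\infty$ for $a\in\mathbb{R}$. Then $\Sigma$ is positive if and only if all entries of $A_{\mathbb{T}}$ and all entries of $B$ are nonnegative. -/

import Mathlib

/-- A time scale: a nonempty closed subset of the real line. -/
def IsTimeScale (T : Set ℝ) : Prop :=
  T.Nonempty ∧ IsClosed T

open Classical in
/-- The forward jump operator of `T`: `σ(t) = inf {s ∈ T : s > t}`, and `σ(t) = t` if `t = max T`. -/
noncomputable def forwardJump (T : Set ℝ) (t : ℝ) : ℝ :=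
  if ∃ s ∈ T, t < s then sInf {s | s ∈ T ∧ t < s} else t

/-- The forward graininess function `μ(t) = σ(t) - t`. -/
noncomputable def graininess (T : Set ℝ) (t : ℝ) : ℝ :=
  forwardJump T t - t

/-- The supremum of the graininess function over `T`, an element of `[0, ∞]`. -/
noncomputable def supGraininess (T : Set ℝ) : ENNReal :=
  ⨆ t ∈ T, ENNReal.ofReal (graininess T t)

/-- `d` is a delta derivative at `t` of the restriction of `f` to the time scale `T`.
With the maximum norm on `Fin n → ℝ` this is the componentwise notion for vector functions. -/
def HasDeltaDeriv {n : ℕ} (T : Set ℝ) (f : ℝ → Fin n → ℝ) (d : Fin n → ℝ) (t : ℝ) : Prop :=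
  ∀ ε : ℝ, 0 < ε → ∃ δ : ℝ, 0 < δ ∧ ∀ s ∈ T, |s - t| < δ →
    ‖(f (forwardJump T t) - f s) - (forwardJump T t - s) • d‖ ≤ ε * |forwardJump T t - s|

/-- The interval `[t₀, t₁)_T`, where `t₁` is a real number or `∞`. -/
def icoT (T : Set ℝ) (t₀ : ℝ) (t₁ : WithTop ℝ) : Set ℝ :=
  {t | t ∈ T ∧ t₀ ≤ t ∧ (t : WithTop ℝ) < t₁}

/-- `u` is a control on `[t₀, t₁)_T`: it is piecewise continuous (finitely many points of
discontinuity in every bounded part of the interval), and at every point of discontinuity it is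
right-continuous and has a finite left-sided limit. (At a point that is not left-dense the
requirement on the left-sided limit is void.) The values of `u` off the interval play no role. -/
structure IsControl {m : ℕ} (T : Set ℝ) (t₀ : ℝ) (t₁ : WithTop ℝ) (u : ℝ → Fin m → ℝ) : Prop where
  finite_discontinuities : ∀ s : ℝ,
    {t | t ∈ icoT T t₀ t₁ ∧ t ≤ s ∧ ¬ ContinuousWithinAt u (icoT T t₀ t₁) t}.Finite
  right_continuous : ∀ t ∈ icoT T t₀ t₁, ¬ ContinuousWithinAt u (icoT T t₀ t₁) t →
    ContinuousWithinAt u (icoT T t₀ t₁ ∩ Set.Ici t) t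
  left_limit : ∀ t ∈ icoT T t₀ t₁, ¬ ContinuousWithinAt u (icoT T t₀ t₁) t →
    ∃ l : Fin m → ℝ, Filter.Tendsto u (nhdsWithin t (icoT T t₀ t₁ ∩ Set.Iio t)) (nhds l)

/-- `x` is, on the interval `[t₀, s]_T`, a forward solution of `x^Δ = A x + B u`, `x(t₀) = x₀`,
for a control `u` given (at least) on `[t₀, s)_T`. The solution is built step by step: it is
continuous, it satisfies the equation at every time at which `u` is continuous, and at a
discontinuity `t` of `u` it satisfies the equation restarted at `t`, that is, on the time scale
`[t, s]_T`. Continuity makes `x(s)` the limit of `x` if `s` is left-dense; the equation at the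
preceding point determines `x(s)` if `s` is left-scattered. -/
structure IsSolution {n m : ℕ} (T : Set ℝ) (A : Matrix (Fin n) (Fin n) ℝ)
    (B : Matrix (Fin n) (Fin m) ℝ) (u : ℝ → Fin m → ℝ) (t₀ : ℝ) (x₀ : Fin n → ℝ) (s : ℝ)
    (x : ℝ → Fin n → ℝ) : Prop where
  initial : x t₀ = x₀
  continuousOn : ContinuousOn x (T ∩ Set.Icc t₀ s)
  equation : ∀ t ∈ T ∩ Set.Ico t₀ s, ContinuousWithinAt u (T ∩ Set.Ico t₀ s) t →
    HasDeltaDeriv (T ∩ Set.Icc t₀ s) x (A.mulVec (x t) + B.mulVec (u t)) t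
  restart : ∀ t ∈ T ∩ Set.Ico t₀ s, ¬ ContinuousWithinAt u (T ∩ Set.Ico t₀ s) t →
    HasDeltaDeriv (T ∩ Set.Icc t s) x (A.mulVec (x t) + B.mulVec (u t)) t

/-- The control system `x^Δ = A x + B u` on `T` is positive: for every `t₀ ∈ T`, every
`x₀ ≥ 0`, every control `u ≥ 0` on `[t₀, t₁)_T` with `t₁ ∈ T` or `t₁ = ∞`, and every
`t ∈ [t₀, t₁]_T`, the solution satisfies `x(t) ≥ 0`. Only the part of the solution on `[t₀, t]_T`
matters for `x(t)`, so no behaviour of `u` near `t₁` has to be prescribed. -/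
def IsPositiveSystem {n m : ℕ} (T : Set ℝ) (A : Matrix (Fin n) (Fin n) ℝ)
    (B : Matrix (Fin n) (Fin m) ℝ) : Prop :=
  ∀ t₀ ∈ T, ∀ t₁ : WithTop ℝ, (t₀ : WithTop ℝ) < t₁ → (∀ r : ℝ, t₁ = (r : WithTop ℝ) → r ∈ T) →
    ∀ x₀ : Fin n → ℝ, (∀ i, 0 ≤ x₀ i) →
    ∀ u : ℝ → Fin m → ℝ, IsControl T t₀ t₁ u → (∀ t ∈ icoT T t₀ t₁, ∀ k, 0 ≤ u t k) →
    ∀ t ∈ T, t₀ ≤ t → (t : WithTop ℝ) ≤ t₁ →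
    ∀ x : ℝ → Fin n → ℝ, IsSolution T A B u t₀ x₀ t x → ∀ i, 0 ≤ x t i

/-- The matrix `A_T = A + I / μ̄` with entries in the extended reals, where `μ̄` is the supremum of
the graininess. The quotient is taken in `[0, ∞]`, where `1 / 0 = ∞` and `1 / ∞ = 0`. -/
noncomputable def matrixAT {n : ℕ} (T : Set ℝ) (A : Matrix (Fin n) (Fin n) ℝ) :
    Matrix (Fin n) (Fin n) EReal :=
  A.map (fun a : ℝ => (a : EReal)) +
    Matrix.diagonal (fun _ => ((1 / supGraininess T : ENNReal) : EReal))

open Set Filter Topology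

/-! ### Forward jumps and induction along a time scale. -/

section ForwardJump

variable {T : Set ℝ} {t s r : ℝ}

/-! Nonnegativity of `A_T` means: `A` is nonnegative off the diagonal and `1 + μ(t) A i i ≥ 0` for
every `t` (`matrixAT_nonneg_iff`).

Sufficiency (`nonneg_of_hasDeltaDeriv`): the barrier `-ε exp((K+1)(t-a))`, with `K` bounding the row
sums of `A`, stays below every component of `x`. This propagates by induction on the time scale:
across a jump because `I + μA` is nonnegative, to the right of a right-dense point by the delta
derivative, into a left-dense point by continuity. Then `ε → 0`.

Necessity: constant controls suffice. A jump forces `y + μ(Ay + Bu) ≥ 0`, which with `y = e_i`, `u =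
0` gives the diagonal condition. If `y i = 0`, then `(Ay + Bu) i ≥ 0`, from one jump or, if there
are none, from the initial slope of an ODE solution; unit vectors then isolate the entries `A i j`
and `B i k`. -/

theorem forwardJump_mem (hT : IsClosed T) (ht : t ∈ T) : forwardJump T t ∈ T := by
  unfold forwardJump
  split_ifs with h
  · obtain ⟨s, hs, hts⟩ := h
    have hb : BddBelow {s | s ∈ T ∧ t < s} := ⟨t, fun r hr => hr.2.le⟩
    exact closure_minimal (fun r hr => hr.1) hT (csInf_mem_closure ⟨s, hs, hts⟩ hb)
  · exact ht

theorem le_forwardJump : t ≤ forwardJump T t := by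
  unfold forwardJump
  split_ifs with h
  · obtain ⟨s, hs, hts⟩ := h
    exact le_csInf ⟨s, hs, hts⟩ fun r hr => hr.2.le
  · exact le_rfl

theorem forwardJump_le (hs : s ∈ T) (hts : t < s) : forwardJump T t ≤ s := by
  have hex : ∃ s ∈ T, t < s := ⟨s, hs, hts⟩
  rw [forwardJump, if_pos hex]
  exact csInf_le ⟨t, fun r hr => hr.2.le⟩ ⟨hs, hts⟩

theorem forwardJump_inter_Icc {a : ℝ} (hs : s ∈ T) (hat : a ≤ t) (hts : t < s) :
    forwardJump (T ∩ Icc a s) t = forwardJump T t := by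
  have hs' : s ∈ T ∩ Icc a s := ⟨hs, by linarith, le_rfl⟩
  have hex' : ∃ r ∈ T ∩ Icc a s, t < r := ⟨s, hs', hts⟩
  have hex : ∃ r ∈ T, t < r := ⟨s, hs, hts⟩
  rw [forwardJump, forwardJump, if_pos hex', if_pos hex]
  apply le_antisymm
  · refine le_csInf ⟨s, hs, hts⟩ fun r hr => ?_
    rcases le_total r s with h | h
    · exact csInf_le ⟨t, fun r hr => hr.2.le⟩ ⟨⟨hr.1, hat.trans hr.2.le, h⟩, hr.2⟩
    · exact le_trans (csInf_le ⟨t, fun r hr => hr.2.le⟩ ⟨hs', hts⟩) h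
  · exact csInf_le_csInf ⟨t, fun r hr => hr.2.le⟩ ⟨s, hs', hts⟩ fun r hr => ⟨hr.1.1, hr.2⟩

theorem exists_mem_Ioo_of_forwardJump_eq (hs : s ∈ T) (hts : t < s) (h : forwardJump T t = t)
    (hr : t < r) : ∃ q ∈ T, t < q ∧ q < r := by
  have hex : ∃ s ∈ T, t < s := ⟨s, hs, hts⟩
  rw [forwardJump, if_pos hex] at h
  obtain ⟨q, hq, hqr⟩ := exists_lt_of_csInf_lt (s := {s | s ∈ T ∧ t < s}) ⟨s, hs, hts⟩ (h.trans_lt hr)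
  exact ⟨q, hq.1, hq.2, hqr⟩

end ForwardJump

/-- The induction principle on a bounded interval of a time scale. -/
theorem timeScale_induction {T : Set ℝ} (hT : IsClosed T) {a b : ℝ} (ha : a ∈ T) (hb : b ∈ T)
    (hab : a ≤ b) (P : ℝ → Prop) (h0 : P a)
    (hscat : ∀ t ∈ T, a ≤ t → t < b → t < forwardJump T t → P t → P (forwardJump T t))
    (hdense : ∀ t ∈ T, a ≤ t → t < b → forwardJump T t = t → P t → ∀ᶠ r in 𝓝[T ∩ Ioc t b] t, P r)
    (hlim : ∀ t ∈ T, a < t → t ≤ b → t ∈ closure (T ∩ Ico a t) → (∀ r ∈ T ∩ Ico a t, P r) → P t) :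
    P b := by
  by_contra hPb
  set D : Set ℝ := {r | r ∈ T ∩ Icc a b ∧ ¬ P r} with hD
  have hbD : b ∈ D := ⟨⟨hb, hab, le_rfl⟩, hPb⟩
  have hDb : BddBelow D := ⟨a, fun r hr => hr.1.2.1⟩
  set c := sInf D with hc
  have hcD : c ∈ closure D := csInf_mem_closure ⟨b, hbD⟩ hDb
  have hcm : c ∈ T ∩ Icc a b :=
    closure_minimal (fun r hr => hr.1) (hT.inter isClosed_Icc) hcD
  have hlt : ∀ r ∈ T ∩ Ico a c, P r := by
    intro r hr
    by_contra hP
    exact absurd (csInf_le hDb ⟨⟨hr.1, hr.2.1, hr.2.2.le.trans hcm.2.2⟩, hP⟩) (not_le.2 hr.2.2)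
  have hPc : P c := by
    rcases hcm.2.1.eq_or_lt with h | hac
    · rwa [← h]
    by_cases hcl : c ∈ closure (T ∩ Ico a c)
    · exact hlim c hcm.1 hac hcm.2.2 hcl hlt
    have hbd : BddAbove (T ∩ Ico a c) := ⟨c, fun r hr => hr.2.2.le⟩
    have hne : (T ∩ Ico a c).Nonempty := ⟨a, ha, le_rfl, hac⟩
    -- If `c` is not left-dense, `p` is its predecessor, so the jump hypothesis applies at `p`.
    set p := sSup (T ∩ Ico a c)
    have hp : p ∈ closure (T ∩ Ico a c) := csSup_mem_closure hne hbd
    have hpm : p ∈ T ∩ Icc a c := closure_minimal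
      (inter_subset_inter_right T Ico_subset_Icc_self) (hT.inter isClosed_Icc) hp
    have hpc : p < c := lt_of_le_of_ne hpm.2.2 fun h => hcl (h ▸ hp)
    have hσ : forwardJump T p = c := by
      apply le_antisymm (forwardJump_le hcm.1 hpc)
      have hex : ∃ s ∈ T, p < s := ⟨c, hcm.1, hpc⟩
      rw [forwardJump, if_pos hex]
      refine le_csInf ⟨c, hcm.1, hpc⟩ fun r hr => ?_
      by_contra! hrc
      exact absurd (le_csSup hbd ⟨hr.1, hpm.2.1.trans hr.2.le, hrc⟩) (not_le.2 hr.2)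
    have := hscat p hpm.1 hpm.2.1 (hpc.trans_le hcm.2.2) (by rwa [hσ])
      (hlt p ⟨hpm.1, hpm.2.1, hpc⟩)
    rwa [hσ] at this
  have hcb : c < b := lt_of_le_of_ne hcm.2.2 fun h => hPb (h ▸ hPc)
  have hgt : ∀ r ∈ D, c < r := fun r hr =>
    lt_of_le_of_ne (csInf_le hDb hr) fun h => hr.2 (h ▸ hPc)
  -- As `P c` holds, failures accumulate at `c` strictly from the right; hence `c` is right-dense
  -- and `hdense` contradicts them.
  have hσ : forwardJump T c = c := by
    refine le_antisymm (le_csInf ⟨b, hbD⟩ fun r hr => ?_) le_forwardJump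
    exact forwardJump_le hr.1.1 (hgt r hr)
  have hev := hdense c hcm.1 hcm.2.1 hcb hσ hPc
  have hsub : D ⊆ T ∩ Ioc c b := fun r hr => ⟨hr.1.1, hgt r hr, hr.1.2.2⟩
  have hev' : ∀ᶠ r in 𝓝[D] c, P r := hev.filter_mono (nhdsWithin_mono _ hsub)
  have : (𝓝[D] c).NeBot := mem_closure_iff_nhdsWithin_neBot.1 hcD
  obtain ⟨r, hr, hrD⟩ := (hev'.and self_mem_nhdsWithin).exists
  exact hrD.2 hr

/-! ### Delta derivatives. -/

section DeltaDeriv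

variable {n m : ℕ} {T S : Set ℝ} {f : ℝ → Fin n → ℝ} {d : Fin n → ℝ} {t : ℝ}

theorem HasDeltaDeriv.mono (h : HasDeltaDeriv T f d t) (hST : S ⊆ T)
    (hσ : forwardJump S t = forwardJump T t) : HasDeltaDeriv S f d t := by
  intro ε hε
  obtain ⟨δ, hδ, H⟩ := h ε hε
  exact ⟨δ, hδ, fun s hs hst => hσ ▸ H s (hST hs) hst⟩

/-- The choice `s = t` is allowed for every tolerance, so the error vanishes. -/
theorem HasDeltaDeriv.apply_forwardJump (h : HasDeltaDeriv T f d t) (ht : t ∈ T) :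
    f (forwardJump T t) = f t + (forwardJump T t - t) • d := by
  have key : ‖(f (forwardJump T t) - f t) - (forwardJump T t - t) • d‖ ≤ 0 := by
    refine le_of_forall_pos_le_add fun ε hε => ?_
    have hpos : 0 < |forwardJump T t - t| + 1 := by positivity
    obtain ⟨δ, hδ, H⟩ := h (ε / (|forwardJump T t - t| + 1)) (by positivity)
    refine (H t ht (by simpa using hδ)).trans ?_
    rw [zero_add, div_mul_eq_mul_div, div_le_iff₀ hpos]
    nlinarith
  have := norm_le_zero_iff.1 key
  rw [sub_sub, sub_eq_zero] at this
  exact this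

theorem HasDerivAt.hasDeltaDeriv (h : HasDerivAt f d t) (hσ : forwardJump T t = t) :
    HasDeltaDeriv T f d t := by
  intro ε hε
  have h1 := (hasDerivAt_iff_isLittleO.1 h).def hε
  obtain ⟨δ, hδ, H⟩ := Metric.eventually_nhds_iff.1 h1
  refine ⟨δ, hδ, fun s _ hst => ?_⟩
  have h2 := H (y := s) (by rwa [Real.dist_eq])
  rw [hσ]
  rw [← norm_neg, Real.norm_eq_abs, abs_sub_comm s t] at h2
  have e : f t - f s - (t - s) • d = -(f s - f t - (s - t) • d) := by module
  rwa [e]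

theorem hasDeltaDeriv_affine (c : Fin n → ℝ) (a : ℝ) :
    HasDeltaDeriv T (fun r => c + (r - a) • d) d t := by
  intro ε hε
  refine ⟨1, one_pos, fun s _ _ => ?_⟩
  have : (c + (forwardJump T t - a) • d - (c + (s - a) • d)) - (forwardJump T t - s) • d = 0 := by
    module
  rw [this, norm_zero]
  positivity

end DeltaDeriv

/-! ### The barrier argument. -/

section Step

variable {n : ℕ} {A : Matrix (Fin n) (Fin n) ℝ}

/-- Row `i` of `I + hA` is nonnegative; apply it to the nonnegative vector `y + c·1`, where the
shift costs `c` times one plus `h` times the row sum. -/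
theorem neg_mul_le_add_mul_mulVec (hA : ∀ i j, i ≠ j → 0 ≤ A i j) {K c h : ℝ} {i : Fin n}
    (hK : ∑ j, A i j ≤ K) (hc : 0 ≤ c) (hh : 0 ≤ h) (hd : 0 ≤ 1 + h * A i i) {y : Fin n → ℝ}
    (hy : ∀ j, -c ≤ y j) : -c * (1 + h * K) ≤ y i + h * A.mulVec y i := by
  have e : A.mulVec (fun j => y j + c) i = A.mulVec y i + (∑ j, A i j) * c := by
    simp only [Matrix.mulVec, dotProduct, mul_add, Finset.sum_add_distrib, Finset.sum_mul]
  have g : A i i * (y i + c) ≤ A.mulVec (fun j => y j + c) i := by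
    rw [Matrix.mulVec, dotProduct, ← Finset.add_sum_erase _ _ (Finset.mem_univ i)]
    refine le_add_of_nonneg_right (Finset.sum_nonneg fun j hj => ?_)
    exact mul_nonneg (hA i j (Finset.ne_of_mem_erase hj).symm) (by linarith [hy j])
  have g1 := mul_le_mul_of_nonneg_left g hh
  have g2 : 0 ≤ (1 + h * A i i) * (y i + c) := mul_nonneg hd (by linarith [hy i])
  have g3 : h * c * (∑ j, A i j) ≤ h * c * K := mul_le_mul_of_nonneg_left hK (by positivity)
  rw [e] at g1
  linarith

/-- A quasi-monotone linear delta-differential inequality preserves nonnegativity. -/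
theorem nonneg_of_hasDeltaDeriv {T : Set ℝ} (hT : IsClosed T) (hA : ∀ i j, i ≠ j → 0 ≤ A i j)
    (hd : ∀ i, ∀ t ∈ T, 0 ≤ 1 + graininess T t * A i i) {a b : ℝ} (ha : a ∈ T) (hb : b ∈ T)
    (hab : a ≤ b) {x v : ℝ → Fin n → ℝ} (hx : ContinuousOn x (T ∩ Icc a b)) (hxa : ∀ i, 0 ≤ x a i)
    (hv : ∀ t ∈ T ∩ Ico a b, ∀ i, 0 ≤ v t i)
    (hder : ∀ t ∈ T ∩ Ico a b, HasDeltaDeriv (T ∩ Icc t b) x (A.mulVec (x t) + v t) t) (i : Fin n) :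
    0 ≤ x b i := by
  obtain ⟨K, hK0, hK⟩ : ∃ K : ℝ, 0 ≤ K ∧ ∀ i, ∑ j, A i j ≤ K :=
    ⟨∑ i, |∑ j, A i j|, by positivity, fun i => (le_abs_self _).trans
      (Finset.single_le_sum (f := fun i => |∑ j, A i j|) (fun _ _ => abs_nonneg _)
        (Finset.mem_univ i))⟩
  have main : ∀ ε : ℝ, 0 < ε → ∀ i, -(ε * Real.exp ((K + 1) * (b - a))) ≤ x b i := by
    intro ε hε
    have hexp : ∀ t h : ℝ, ε * Real.exp ((K + 1) * (t - a)) * (1 + h * (K + 1)) ≤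
        ε * Real.exp ((K + 1) * (t + h - a)) := by
      intro t h
      have h1 : (K + 1) * (t + h - a) = (K + 1) * (t - a) + h * (K + 1) := by ring
      rw [h1, Real.exp_add, ← mul_assoc]
      exact mul_le_mul_of_nonneg_left (by linarith [Real.add_one_le_exp (h * (K + 1))])
        (by positivity)
    apply timeScale_induction hT ha hb hab
      (fun t => ∀ i, -(ε * Real.exp ((K + 1) * (t - a))) ≤ x t i)
    · intro i
      have : 0 ≤ ε * Real.exp ((K + 1) * (a - a)) := by positivity
      linarith [hxa i]
    · intro t ht hat htb hσ hP i
      have h1 := (hder t ⟨ht, hat, htb⟩).apply_forwardJump ⟨ht, le_rfl, htb.le⟩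
      rw [forwardJump_inter_Icc hb le_rfl htb] at h1
      have h0 : 0 ≤ graininess T t := sub_nonneg.2 hσ.le
      have h2 := neg_mul_le_add_mul_mulVec hA (hK i)
        (c := ε * Real.exp ((K + 1) * (t - a))) (by positivity) h0 (hd i t ht) hP
      have h3 := hexp t (graininess T t)
      have h4 := mul_nonneg h0 (hv t ⟨ht, hat, htb⟩ i)
      have h5 : 0 ≤ ε * Real.exp ((K + 1) * (t - a)) * graininess T t := by positivity
      have h6 : t + graininess T t = forwardJump T t := by unfold graininess; ring
      rw [h6] at h3
      rw [h1]
      simp only [Pi.add_apply, Pi.smul_apply, smul_eq_mul]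
      change _ ≤ x t i + graininess T t * _
      linarith
    · intro t ht hat htb hσ hP
      set c := ε * Real.exp ((K + 1) * (t - a)) with hc
      have hc0 : 0 < c := by positivity
      -- The tolerance is the barrier height itself: the error `c (r - t)` is absorbed by the extra
      -- `1` in `K + 1`.
      obtain ⟨δ, hδ, H⟩ := hder t ⟨ht, hat, htb⟩ c hc0
      rw [forwardJump_inter_Icc hb le_rfl htb, hσ] at H
      have e1 : ∀ᶠ r in 𝓝[T ∩ Ioc t b] t, |r - t| < δ :=
        mem_nhdsWithin_of_mem_nhds (Metric.ball_mem_nhds t hδ)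
      have e2 : ∀ᶠ r in 𝓝[T ∩ Ioc t b] t, ∀ i, 0 < 1 + (r - t) * A i i := by
        refine eventually_all.2 fun i => mem_nhdsWithin_of_mem_nhds ?_
        have : ContinuousAt (fun r : ℝ => 1 + (r - t) * A i i) t := by fun_prop
        exact this.eventually_const_lt (by simp)
      filter_upwards [e1, e2, self_mem_nhdsWithin] with r hr1 hr2 hr3 i
      have hrt : 0 < r - t := sub_pos.2 hr3.2.1
      have h1 := (norm_le_pi_norm _ i).trans (H r ⟨hr3.1, hr3.2.1.le, hr3.2.2⟩ hr1)
      rw [Real.norm_eq_abs, abs_sub_comm t r, abs_of_pos hrt] at h1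
      have h1' := (abs_le.1 h1).2
      simp only [Pi.sub_apply, Pi.add_apply, Pi.smul_apply, smul_eq_mul] at h1'
      have h2 := neg_mul_le_add_mul_mulVec hA (hK i) hc0.le hrt.le (hr2 i).le hP
      have h3 := hexp t (r - t)
      have h4 := mul_nonneg hrt.le (hv t ⟨ht, hat, htb⟩ i)
      rw [add_sub_cancel] at h3
      linarith
    · intro t ht hat htb hcl hP i
      have hne : (𝓝[T ∩ Ico a t] t).NeBot := mem_closure_iff_nhdsWithin_neBot.1 hcl
      have hxt : Tendsto (fun r => x r i) (𝓝[T ∩ Ico a t] t) (𝓝 (x t i)) :=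
        (tendsto_pi_nhds.1 ((hx t ⟨ht, hat.le, htb⟩).mono
          fun r hr => ⟨hr.1, hr.2.1, hr.2.2.le.trans htb⟩)) i
      have hφ : Tendsto (fun r => -(ε * Real.exp ((K + 1) * (r - a)))) (𝓝[T ∩ Ico a t] t)
          (𝓝 (-(ε * Real.exp ((K + 1) * (t - a))))) := by
        have : Continuous fun r : ℝ => -(ε * Real.exp ((K + 1) * (r - a))) := by fun_prop
        exact this.continuousAt.continuousWithinAt
      refine le_of_tendsto_of_tendsto hφ hxt ?_
      filter_upwards [self_mem_nhdsWithin] with r hr using hP r hr i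
  by_contra! hneg
  have hE := Real.exp_pos ((K + 1) * (b - a))
  have := main (-(x b i) / (2 * Real.exp ((K + 1) * (b - a))))
    (div_pos (by linarith) (by positivity)) i
  have e : -(x b i) / (2 * Real.exp ((K + 1) * (b - a))) * Real.exp ((K + 1) * (b - a)) =
      -(x b i) / 2 := by field_simp
  rw [e] at this
  linarith

end Step

/-! ### The entries of `A_T`. -/

section Entries

/-- For `a < 0` this is `-a ≤ 1/μ̄`, that is, `μ̄ ≤ 1/(-a)`. Inverting in `ENNReal` handles `μ̄ = 0`
and `μ̄ = ∞` uniformly. -/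
theorem coe_add_one_div_supGraininess_nonneg_iff {T : Set ℝ} (a : ℝ) :
    0 ≤ (a : EReal) + ((1 / supGraininess T : ENNReal) : EReal) ↔
      ∀ t ∈ T, 0 ≤ 1 + graininess T t * a := by
  have hg : ∀ t, 0 ≤ graininess T t := fun t => sub_nonneg.2 le_forwardJump
  rcases le_or_gt 0 a with ha | ha
  · refine iff_of_true (add_nonneg (by exact_mod_cast ha) (EReal.coe_ennreal_nonneg _)) fun t _ => ?_
    have := mul_nonneg (hg t) ha
    linarith
  have hna : 0 < -a := by linarith
  have e1 : 0 ≤ (a : EReal) + ((1 / supGraininess T : ENNReal) : EReal) ↔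
      ENNReal.ofReal (-a) ≤ 1 / supGraininess T := by
    rw [← EReal.coe_ennreal_le_coe_ennreal_iff, EReal.coe_ennreal_ofReal, max_eq_left hna.le]
    generalize ((1 / supGraininess T : ENNReal) : EReal) = y
    induction y with
    | bot => simp
    | top => simp
    | coe y =>
      norm_cast
      constructor <;> intro h <;> linarith
  rw [e1, one_div, ENNReal.le_inv_iff_le_inv, ← ENNReal.ofReal_inv_of_pos hna, supGraininess,
    iSup₂_le_iff]
  refine forall₂_congr fun t _ => ?_
  rw [ENNReal.ofReal_le_ofReal_iff (by positivity), ← one_div, le_div_iff₀ hna]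
  constructor <;> intro h <;> linarith

theorem matrixAT_nonneg_iff {n : ℕ} {T : Set ℝ} {A : Matrix (Fin n) (Fin n) ℝ} :
    (∀ i j, 0 ≤ matrixAT T A i j) ↔
      (∀ i j, i ≠ j → 0 ≤ A i j) ∧ ∀ i, ∀ t ∈ T, 0 ≤ 1 + graininess T t * A i i := by
  have hdiag : ∀ i, 0 ≤ matrixAT T A i i ↔ ∀ t ∈ T, 0 ≤ 1 + graininess T t * A i i := by
    intro i
    rw [← coe_add_one_div_supGraininess_nonneg_iff]
    simp [matrixAT]
  have hoff : ∀ i j, i ≠ j → (0 ≤ matrixAT T A i j ↔ 0 ≤ A i j) := by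
    intro i j hij
    simp [matrixAT, Matrix.diagonal_apply_ne _ hij]
  refine ⟨fun h => ⟨fun i j hij => (hoff i j hij).1 (h i j), fun i => (hdiag i).1 (h i i)⟩,
    fun h i j => ?_⟩
  by_cases hij : i = j
  · subst hij
    exact (hdiag i).2 (h.2 i)
  · exact (hoff i j hij).2 (h.1 i j hij)

end Entries

/-! ### The two implications. -/

section PositiveSystem

variable {n m : ℕ} {T : Set ℝ} {A : Matrix (Fin n) (Fin n) ℝ} {B : Matrix (Fin n) (Fin m) ℝ}

theorem mulVec_apply_nonneg (hB : ∀ i k, 0 ≤ B i k) {u : Fin m → ℝ} (hu : ∀ k, 0 ≤ u k)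
    (i : Fin n) : 0 ≤ B.mulVec u i := by
  rw [Matrix.mulVec, dotProduct]
  exact Finset.sum_nonneg fun k _ => mul_nonneg (hB i k) (hu k)

theorem isPositiveSystem_of_nonneg (hT : IsClosed T) (hA : ∀ i j, i ≠ j → 0 ≤ A i j)
    (hd : ∀ i, ∀ t ∈ T, 0 ≤ 1 + graininess T t * A i i) (hB : ∀ i k, 0 ≤ B i k) :
    IsPositiveSystem T A B := by
  intro t₀ ht₀ t₁ _ _ x₀ hx₀ u _ hu0 s hs hts hst x hx
  refine nonneg_of_hasDeltaDeriv hT hA hd ht₀ hs hts hx.continuousOn (v := fun t => B.mulVec (u t))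
    (by rwa [hx.initial]) ?_ ?_
  · intro t ht
    exact mulVec_apply_nonneg hB
      (hu0 t ⟨ht.1, ht.2.1, (WithTop.coe_lt_coe.2 ht.2.2).trans_le hst⟩)
  · intro t ht
    -- Restricting to `[t, s]_T` keeps the forward jump, so both clauses of a solution yield the
    -- one-sided derivative.
    by_cases hc : ContinuousWithinAt u (T ∩ Ico t₀ s) t
    · refine (hx.equation t ht hc).mono (fun r hr => ⟨hr.1, ht.2.1.trans hr.2.1, hr.2.2⟩) ?_
      rw [forwardJump_inter_Icc hs le_rfl ht.2.2, forwardJump_inter_Icc hs ht.2.1 ht.2.2]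
    · exact hx.restart t ht hc

theorem isControl_const (t₀ : ℝ) (t₁ : WithTop ℝ) (u : Fin m → ℝ) :
    IsControl T t₀ t₁ (fun _ => u) where
  finite_discontinuities s := by simp [continuousWithinAt_const]
  right_continuous t _ h := absurd continuousWithinAt_const h
  left_limit t _ h := absurd continuousWithinAt_const h

theorem IsPositiveSystem.nonneg_of_const (h : IsPositiveSystem T A B) {a b : ℝ} (ha : a ∈ T)
    (hb : b ∈ T) (hab : a < b) {u : Fin m → ℝ} (hu : ∀ k, 0 ≤ u k) {x : ℝ → Fin n → ℝ}
    (hxa : ∀ i, 0 ≤ x a i) (hx : ContinuousOn x (T ∩ Icc a b))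
    (hder : ∀ t ∈ T ∩ Ico a b, HasDeltaDeriv (T ∩ Icc a b) x (A.mulVec (x t) + B.mulVec u) t)
    (i : Fin n) : 0 ≤ x b i :=
  h a ha b (WithTop.coe_lt_coe.2 hab) (fun r hr => by rwa [← WithTop.coe_injective hr])
    (x a) hxa (fun _ => u) (isControl_const _ _ _) (fun _ _ => hu) b hb hab.le le_rfl x
    ⟨rfl, hx, fun t ht _ => hder t ht, fun t _ hc => absurd continuousWithinAt_const hc⟩ i

/-- At a right-scattered `t`, the only point of `[t, σ(t))_T` is `t`, so an affine function is a
solution there. -/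
theorem IsPositiveSystem.scattered_step_nonneg (h : IsPositiveSystem T A B) (hT : IsClosed T)
    {t : ℝ} (ht : t ∈ T) {y : Fin n → ℝ} (hy : ∀ i, 0 ≤ y i) {u : Fin m → ℝ} (hu : ∀ k, 0 ≤ u k)
    (i : Fin n) : 0 ≤ y i + graininess T t * (A.mulVec y + B.mulVec u) i := by
  rcases (le_forwardJump (T := T) (t := t)).eq_or_lt with hσ | hσ
  · rw [graininess, ← hσ]
    simpa using hy i
  refine h.nonneg_of_const ht (forwardJump_mem hT ht) hσ hu
    (x := fun r => y + (r - t) • (A.mulVec y + B.mulVec u)) (by simpa using hy)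
    (by fun_prop) (fun r hr => ?_) i
  have hrt : r = t := by
    by_contra hne
    exact absurd (forwardJump_le hr.1 (lt_of_le_of_ne hr.2.1 (Ne.symm hne))) (not_le.2 hr.2.2)
  subst hrt
  simpa using hasDeltaDeriv_affine (d := A.mulVec y + B.mulVec u) y r

/-- A local ODE solution from `y` (Picard–Lindelöf) restricts to a solution on `T`. Its `i`-th
component starts at `0` and stays nonnegative on `T`, so its slopes along points of `T` decreasing
to `a` have a nonnegative limit. -/
theorem IsPositiveSystem.vectorField_nonneg_of_dense (h : IsPositiveSystem T A B)
    (hσ : ∀ t ∈ T, forwardJump T t = t) {a b : ℝ} (ha : a ∈ T) (hb : b ∈ T) (hab : a < b)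
    {y : Fin n → ℝ} (hy : ∀ i, 0 ≤ y i) {u : Fin m → ℝ} (hu : ∀ k, 0 ≤ u k) {i : Fin n}
    (hi : y i = 0) : 0 ≤ (A.mulVec y + B.mulVec u) i := by
  have hsmooth : ContDiffAt ℝ 1 (fun z : Fin n → ℝ => A.mulVec z + B.mulVec u) y := by
    have : ContDiff ℝ 1 (fun z : Fin n → ℝ => (LinearMap.toContinuousLinearMap A.mulVecLin) z) :=
      ContinuousLinearMap.contDiff _
    exact (this.add contDiff_const).contDiffAt
  obtain ⟨x, hxa, ε, hε, hx⟩ := 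
    hsmooth.exists_forall_mem_closedBall_exists_eq_forall_mem_Ioo_hasDerivAt₀ a
  have hpos : ∀ r ∈ T, a < r → r < a + ε → 0 ≤ x r i := by
    intro r hr har hre
    have hmem : ∀ t ∈ Icc a r, t ∈ Ioo (a - ε) (a + ε) := fun t ht =>
      ⟨by linarith [ht.1], by linarith [ht.2]⟩
    refine h.nonneg_of_const ha hr har hu (by rwa [hxa])
      (fun t ht => (hx t (hmem t ht.2)).continuousAt.continuousWithinAt) (fun t ht => ?_) i
    refine (hx t (hmem t ⟨ht.2.1, ht.2.2.le⟩)).hasDeltaDeriv ?_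
    rw [forwardJump_inter_Icc hr ht.2.1 ht.2.2, hσ t ht.1]
  have hcl : a ∈ closure (T ∩ Ioi a) := by
    refine Metric.mem_closure_iff.2 fun δ hδ => ?_
    obtain ⟨q, hq, haq, hqδ⟩ := exists_mem_Ioo_of_forwardJump_eq hb hab (hσ a ha)
      (show a < a + δ by linarith)
    exact ⟨q, ⟨hq, haq⟩, by rw [dist_comm, Real.dist_eq, abs_of_pos] <;> linarith⟩
  have hne : (𝓝[T ∩ Ioi a] a).NeBot := mem_closure_iff_nhdsWithin_neBot.1 hcl
  have hder := (hasDerivAt_pi.1 (hx a ⟨by linarith, by linarith⟩) i).hasDerivWithinAt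
    (s := T ∩ Ioi a)
  rw [hasDerivWithinAt_iff_tendsto_slope' (fun hmem => lt_irrefl a hmem.2), hxa] at hder
  refine ge_of_tendsto hder ?_
  have e1 : ∀ᶠ r in 𝓝[T ∩ Ioi a] a, r < a + ε :=
    mem_nhdsWithin_of_mem_nhds (Iio_mem_nhds (by linarith))
  filter_upwards [e1, self_mem_nhdsWithin] with r hr1 hr2
  rw [slope_def_field, hxa, hi, sub_zero]
  exact div_nonneg (hpos r hr2.1 hr2.2 hr1) (sub_nonneg.2 hr2.2.le)

theorem IsPositiveSystem.vectorField_nonneg (h : IsPositiveSystem T A B) (hT : IsClosed T)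
    (hnt : T.Nontrivial) {y : Fin n → ℝ} (hy : ∀ i, 0 ≤ y i) {u : Fin m → ℝ} (hu : ∀ k, 0 ≤ u k)
    {i : Fin n} (hi : y i = 0) : 0 ≤ (A.mulVec y + B.mulVec u) i := by
  by_cases hσ : ∀ t ∈ T, forwardJump T t = t
  · obtain ⟨a, ha, b, hb, hab⟩ := hnt.exists_lt
    exact h.vectorField_nonneg_of_dense hσ ha hb hab hy hu hi
  · push Not at hσ
    obtain ⟨t, ht, hne⟩ := hσ
    have hpos : 0 < graininess T t := sub_pos.2 (lt_of_le_of_ne le_forwardJump (Ne.symm hne))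
    have := h.scattered_step_nonneg hT ht hy hu i
    rw [hi, zero_add] at this
    exact nonneg_of_mul_nonneg_right this hpos

end PositiveSystem

theorem mainTheorem3 (n m : ℕ) (hn : 1 ≤ n) (T : Set ℝ) (hT : IsTimeScale T)
    (hcard : ((n + 1 : ℕ) : ℕ∞) ≤ T.encard)
    (A : Matrix (Fin n) (Fin n) ℝ) (B : Matrix (Fin n) (Fin m) ℝ) :
    IsPositiveSystem T A B ↔ (∀ i j, 0 ≤ matrixAT T A i j) ∧ (∀ i k, 0 ≤ B i k) := by
  rw [matrixAT_nonneg_iff]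
  refine ⟨fun h => ?_, fun h => isPositiveSystem_of_nonneg hT.2 h.1.1 h.1.2 h.2⟩
  have hnt : T.Nontrivial := by
    rw [← Set.one_lt_encard_iff_nontrivial]
    refine lt_of_lt_of_le ?_ hcard
    exact_mod_cast Nat.lt_succ_of_le hn
  have hsingle : ∀ {p : ℕ} (j k : Fin p), (0 : ℝ) ≤ (Pi.single j 1 : Fin p → ℝ) k := by
    intro p j k
    exact (Pi.single_nonneg.2 zero_le_one : (0 : Fin p → ℝ) ≤ Pi.single j 1) k
  refine ⟨⟨fun i j hij => ?_, fun i t ht => ?_⟩, fun i k => ?_⟩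
  · simpa using h.vectorField_nonneg hT.2 hnt (hsingle j) (u := 0) (fun _ => le_rfl)
      (Pi.single_eq_of_ne hij 1)
  · simpa using h.scattered_step_nonneg hT.2 ht (hsingle i) (u := 0) (fun _ => le_rfl) i
  · simpa using h.vectorField_nonneg hT.2 hnt (y := 0) (fun _ => le_rfl) (hsingle k) (i := i) rfl
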